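/- Let $N\ge 2$ be an integer, $a\in\mathbb{R}$ and $1<p<\infty$, and let $\mathbb{T}^N=(\mathbb{R}/2\pi\mathbb{Z})^N$ with Lebesgue measure. For a Schwartz function $g$ on $\mathbb{R}^N$ put $\hat g(\xi)=(2\pi)^{-N/2}\int_{\mathbb{R}^N}g(x)e^{-ix\cdot\xi}\,dx$ and $$E_{(\lambda,a)}g(x)=(2\pi)^{-N/2}\int_{|\xi|^2<\lambda}(1+|\xi|^2)^{-a/2}\,\hat g(\xi)\,e^{ix\cdot\xi}\,d\xi,\qquad E^\star_{(a)}g(x)=\sup_{\lambda>0}|E_{(\lambda,a)}g(x)|.$$ For $G\in L_p(\mathbb{T}^N)$ put $G_n=(2\pi)^{-N}\int_{\mathbb{T}^N}G(y)e^{-in\cdot y}\,dy$ for $n\in\mathbb{Z}^N$ and $$S_{(\lambda,a)}G(x)=\sum_{|n|^2<\lambda}(1+|n|^2)^{-a/2}\,G_n\,e^{in\cdot x},\qquad S^\star_{(a)}G(x)=\sup_{\lambda>0}|S_{(\lambda,a)}G(x)|.$$ Write $\|f\|_{L_{p,\infty}}=\sup_{t>0}\,t\,|\{x:|f(x)|>t\}|^{1/p}$,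 where $|\cdot|$ of a set is its Lebesgue measure. (i) If $E^\star_{(a)}$ is bounded on $L_p(\mathbb{R}^N)$, that is, if there is a constant $C$ with $\|E^\star_{(a)}g\|_{L_p(\mathbb{R}^N)}\le C\|g\|_{L_p(\mathbb{R}^N)}$ for all $g$ in the (dense) Schwartz space, then $S^\star_{(a)}$ is bounded on $L_p(\mathbb{T}^N)$: there is a constant $C'$ with $\|S^\star_{(a)}G\|_{L_p(\mathbb{T}^N)}\le C'\|G\|_{L_p(\mathbb{T}^N)}$ for all $G\in L_p(\mathbb{T}^N)$. (ii) If $E^\star_{(a)}$ is weakly bounded on $L_p(\mathbb{R}^N)$, that is, if there is a constant $C$ with $\|E^\star_{(a)}g\|_{L_{p,\infty}(\mathbb{R}^N)}\le C\|g\|_{L_p(\mathbb{R}^N)}$ for all Schwartz functions $g$, then $S^\star_{(a)}$ is weakly bounded on $L_p(\mathbb{T}^N)$: there is a constant $C'$ with $\|S^\star_{(a)}G\|_{L_{p,\infty}(\mathbb{T}^N)}\le C'\|G\|_{L_p(\mathbb{T}^N)}$ for all $G\in L_p(\mathbb{T}^N)$. -/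

import Mathlib

open MeasureTheory Real
open scoped ENNReal NNReal SchwartzMap RealInnerProductSpace

noncomputable section

namespace SphericalMeans

/-- The Euclidean space of dimension `N`, with the norm `|ξ|` and Lebesgue measure `volume`. -/
abbrev Space (N : ℕ) : Type := EuclideanSpace ℝ (Fin N)

instance fact_two_pi_pos : Fact (0 < 2 * π) := ⟨Real.two_pi_pos⟩

/-- The torus `(ℝ / 2πℤ) ^ N`; its `volume` is Lebesgue measure, of total mass `(2π) ^ N`. -/
abbrev Torus (N : ℕ) : Type := Fin N → AddCircle (2 * π)

/-- The unitary Fourier transform `(2π)^(-N/2) ∫ g(x) e^{-i x·ξ} dx`. -/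
def fourierT {N : ℕ} (g : Space N → ℂ) (ξ : Space N) : ℂ :=
  (((2 * π) ^ (-(N : ℝ) / 2) : ℝ) : ℂ) *
    ∫ x : Space N, g x * Complex.exp (-(Complex.I * ((⟪x, ξ⟫ : ℝ) : ℂ)))

/-- The spherical partial integral
`(2π)^(-N/2) ∫_{|ξ|² < r} (1 + |ξ|²)^(-a/2) ĝ(ξ) e^{i x·ξ} dξ`. -/
def partialIntegral {N : ℕ} (a r : ℝ) (g : Space N → ℂ) (x : Space N) : ℂ :=
  (((2 * π) ^ (-(N : ℝ) / 2) : ℝ) : ℂ) *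
    ∫ ξ in {ξ : Space N | ‖ξ‖ ^ 2 < r},
      (((1 + ‖ξ‖ ^ 2) ^ (-a / 2) : ℝ) : ℂ) * fourierT g ξ *
        Complex.exp (Complex.I * ((⟪x, ξ⟫ : ℝ) : ℂ))

/-- The maximal operator `sup_{r > 0}` of the spherical partial integrals, with values
in `[0, ∞]`. -/
def maximalIntegral {N : ℕ} (a : ℝ) (g : Space N → ℂ) (x : Space N) : ℝ≥0∞ :=
  ⨆ (r : ℝ) (_ : 0 < r), ‖partialIntegral a r g x‖ₑ

/-- The square `|n|² = n₁² + ⋯ + n_N²` of the Euclidean length of a lattice point. -/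
def latticeNormSq {N : ℕ} (n : Fin N → ℤ) : ℝ := ∑ i, (n i : ℝ) ^ 2

theorem finite_lattice_ball (N : ℕ) (r : ℝ) :
    {n : Fin N → ℤ | latticeNormSq n < r}.Finite := by
  refine (Set.finite_Icc (fun _ : Fin N => -⌈r⌉) (fun _ : Fin N => ⌈r⌉)).subset ?_
  intro n hn
  have key : ∀ i, |n i| ≤ ⌈r⌉ := by
    intro i
    have h1 : (n i : ℝ) ^ 2 ≤ latticeNormSq n :=
      Finset.single_le_sum (f := fun j => (n j : ℝ) ^ 2) (fun j _ => sq_nonneg _)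
        (Finset.mem_univ i)
    have h2 : ((n i ^ 2 : ℤ) : ℝ) ≤ (⌈r⌉ : ℝ) := by
      push_cast
      exact (h1.trans (le_of_lt hn)).trans (Int.le_ceil r)
    have h3 : n i ^ 2 ≤ ⌈r⌉ := by exact_mod_cast h2
    have h4 : |n i| ≤ n i ^ 2 := by
      rw [← sq_abs]
      exact Int.le_self_sq _
    exact h4.trans h3
  exact ⟨fun i => (abs_le.mp (key i)).1, fun i => (abs_le.mp (key i)).2⟩

/-- The finite set of the lattice points `n` with `|n|² < r`. -/
def latticeBall (N : ℕ) (r : ℝ) : Finset (Fin N → ℤ) := (finite_lattice_ball N r).toFinset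

/-- The character `x ↦ e^{i n·x}` of the torus. -/
def torusChar {N : ℕ} (n : Fin N → ℤ) (x : Torus N) : ℂ := ∏ i, fourier (n i) (x i)

/-- The Fourier coefficient `(2π)^(-N) ∫ G(y) e^{-i n·y} dy` over the torus. -/
def torusCoeff {N : ℕ} (G : Torus N → ℂ) (n : Fin N → ℤ) : ℂ :=
  ((2 * π : ℝ) : ℂ)⁻¹ ^ N * ∫ y : Torus N, G y * torusChar (-n) y

/-- The spherical partial sum `∑_{|n|² < r} (1 + |n|²)^(-a/2) G_n e^{i n·x}`. -/
def partialSum {N : ℕ} (a r : ℝ) (G : Torus N → ℂ) (x : Torus N) : ℂ :=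
  ∑ n ∈ latticeBall N r,
    (((1 + latticeNormSq n) ^ (-a / 2) : ℝ) : ℂ) * torusCoeff G n * torusChar n x

/-- The maximal operator `sup_{r > 0}` of the spherical partial sums, with values in `[0, ∞]`. -/
def maximalSum {N : ℕ} (a : ℝ) (G : Torus N → ℂ) (x : Torus N) : ℝ≥0∞ :=
  ⨆ (r : ℝ) (_ : 0 < r), ‖partialSum a r G x‖ₑ

/-- The weak `L_p` quasi-norm `sup_{t > 0} t μ{f > t}^(1/p)` of a function with values
in `[0, ∞]`. -/
def weakNorm {X : Type*} [MeasurableSpace X] (f : X → ℝ≥0∞) (p : ℝ≥0∞) (μ : Measure X) :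
    ℝ≥0∞ :=
  ⨆ (t : ℝ≥0) (_ : 0 < t), (t : ℝ≥0∞) * μ {x | (t : ℝ≥0∞) < f x} ^ (1 / p.toReal)

/-- Boundedness on `L_p(ℝ^N)` of the maximal operator of the spherical partial integrals: the
`L_p` inequality on the Schwartz space, which is dense in `L_p` and on which the defining integrals
converge absolutely. (For `p > 2` the Fourier transform of a general `L_p` function is not a
function.) -/
def IntegralBounded (N : ℕ) (a : ℝ) (p : ℝ≥0∞) : Prop :=
  ∃ C : ℝ≥0, ∀ g : 𝓢(Space N, ℂ),
    eLpNorm (maximalIntegral a g) p volume ≤ C * eLpNorm g p volume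

/-- Weak boundedness on `L_p(ℝ^N)` (from `L_p` to weak `L_p`) of the maximal operator of the
spherical partial integrals, again as an inequality on the Schwartz space. -/
def IntegralWeaklyBounded (N : ℕ) (a : ℝ) (p : ℝ≥0∞) : Prop :=
  ∃ C : ℝ≥0, ∀ g : 𝓢(Space N, ℂ),
    weakNorm (maximalIntegral a g) p volume ≤ C * eLpNorm g p volume

/-- Boundedness on `L_p` of the torus of the maximal operator of the spherical partial sums. -/
def SumBounded (N : ℕ) (a : ℝ) (p : ℝ≥0∞) : Prop :=
  ∃ C : ℝ≥0, ∀ G : Torus N → ℂ, MemLp G p volume →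
    eLpNorm (maximalSum a G) p volume ≤ C * eLpNorm G p volume

/-- Weak boundedness on `L_p` of the torus (from `L_p` to weak `L_p`) of the maximal operator of
the spherical partial sums. -/
def SumWeaklyBounded (N : ℕ) (a : ℝ) (p : ℝ≥0∞) : Prop :=
  ∃ C : ℝ≥0, ∀ G : Torus N → ℂ, MemLp G p volume →
    weakNorm (maximalSum a G) p volume ≤ C * eLpNorm G p volume

end SphericalMeans

end

/-! This is a transference argument for multipliers. On the torus the partial sum multiplies
`e^{in·x}` by `symbol a r n`. On the Euclidean space take the packet `e^{in·x} φ(x/M)` with a fixed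
bump `φ`: its transform concentrates at `n` on the scale `1/M`. If the symbol is continuous at `n`,
the partial integral therefore multiplies the packet by nearly the same number, uniformly in `x`
(`norm_partialIntegral_sub_le`, `tendsto_symbolError`). The symbol jumps only on the sphere `|ξ|² =
r`. Since `|n|²` is an integer, the radii `r = k + 1/2` give every partial sum and put no lattice
point on that sphere (`latticeBall_eq`, `latticeNormSq_ne`).

Fix finitely many such radii, approximate `G` in `L_p` by a trigonometric polynomial, lift it to the
space and multiply it by `φ(x/M)`. On a cube of `M^N` periods the bump is 1, so there the maximal
integral dominates the truncated maximal sum up to a small error. The cut-off function lives on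
`(4(N+1)M)^N` periods, so its norm is at most `(4(N+1)M)^{N/p}` times that of the polynomial. The
factor `M^{N/p}` appears on both sides and cancels, leaving a constant that depends on neither the
number of radii nor the error. Monotone convergence then yields the full maximal operator.

The strong and the weak norm enter only through the properties collected in `IsTransferable`, so one
argument gives both claims. -/

noncomputable section

namespace SphericalMeans

/-! ### Cubes of whole periods covering the torus -/

/-- The covering map of the torus by the Euclidean space. -/
def covering (N : ℕ) (x : Space N) : Torus N := fun i => (x i : AddCircle (2 * π))

/-- Each period maps onto the circle with its measure preserved, so `M` consecutive periods count
the circle `M` times. The induction appends one period. -/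
theorem measurePreserving_mk_Ioc (b : ℝ) (M : ℕ) :
    MeasurePreserving (fun x : ℝ => (x : AddCircle (2 * π)))
      (volume.restrict (Set.Ioc b (b + M * (2 * π)))) ((M : ℝ≥0∞) • volume) := by
  induction M with
  | zero => 
    refine ⟨AddCircle.measurable_mk', by simp⟩
  | succ M ih =>
    refine ⟨AddCircle.measurable_mk', ?_⟩
    have h := AddCircle.measurePreserving_mk (2 * π) (b + M * (2 * π))
    have hpos : 0 ≤ (M : ℝ) * (2 * π) := by positivity
    have hU : Set.Ioc b (b + ((M + 1 : ℕ) : ℝ) * (2 * π)) =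
        Set.Ioc b (b + M * (2 * π)) ∪
          Set.Ioc (b + M * (2 * π)) (b + M * (2 * π) + 2 * π) := by
      rw [Set.Ioc_union_Ioc_eq_Ioc (by linarith) (by linarith [Real.two_pi_pos])]
      congr 1; push_cast; ring
    rw [hU, Measure.restrict_union (Set.Ioc_disjoint_Ioc_of_le le_rfl) measurableSet_Ioc,
      Measure.map_add _ _ AddCircle.measurable_mk', ih.map_eq]
    have h2 := h.map_eq
    change Measure.map (fun x : ℝ => (x : AddCircle (2 * π))) _ = _ at h2
    rw [h2]
    push_cast
    rw [add_smul, one_smul]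

theorem pi_smul_volume (N M : ℕ) :
    Measure.pi (fun _ : Fin N => (M : ℝ≥0∞) • (volume : Measure (AddCircle (2 * π)))) =
      ((M : ℝ≥0∞) ^ N) • (volume : Measure (Torus N)) := by
  have : IsFiniteMeasure ((M : ℝ≥0∞) • (volume : Measure (AddCircle (2 * π)))) :=
    Measure.smul_finite _ (ENNReal.natCast_ne_top M)
  refine Measure.pi_eq fun s hs => ?_
  simp [volume_pi_pi, Finset.prod_mul_distrib]

/-- The cube with the sides `(b, b + 2πM]`. -/
def cube (N : ℕ) (b : ℝ) (M : ℕ) : Set (Space N) :=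
  {x | ∀ i, x i ∈ Set.Ioc b (b + M * (2 * π))}

theorem measurableSet_cube (N : ℕ) (b : ℝ) (M : ℕ) : MeasurableSet (cube N b M) := by
  unfold cube
  rw [Set.ofPred_forall]
  exact MeasurableSet.iInter fun i =>
    measurableSet_Ioc.preimage (EuclideanSpace.proj (𝕜 := ℝ) i).continuous.measurable

theorem measurePreserving_covering (N : ℕ) (b : ℝ) (M : ℕ) :
    MeasurePreserving (covering N) (volume.restrict (cube N b M))
      (((M : ℝ≥0∞) ^ N) • (volume : Measure (Torus N))) := by
  have : IsFiniteMeasure ((M : ℝ≥0∞) • (volume : Measure (AddCircle (2 * π)))) :=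
    Measure.smul_finite _ (ENNReal.natCast_ne_top M)
  have h1 := measurePreserving_pi (fun _ : Fin N => volume.restrict (Set.Ioc b (b + M * (2 * π))))
    (fun _ : Fin N => (M : ℝ≥0∞) • (volume : Measure (AddCircle (2 * π))))
    (fun _ => measurePreserving_mk_Ioc b M)
  rw [pi_smul_volume, ← Measure.restrict_pi_pi] at h1
  have h2 := (EuclideanSpace.volume_preserving_symm_measurableEquiv_toLp (Fin N)).restrict_preimage 
    (s := Set.univ.pi fun _ => Set.Ioc b (b + M * (2 * π)))
    (MeasurableSet.univ_pi fun _ => measurableSet_Ioc)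
  have h3 := h1.comp h2
  have hc : cube N b M = (MeasurableEquiv.toLp 2 (Fin N → ℝ)).symm ⁻¹'
      Set.univ.pi fun _ => Set.Ioc b (b + M * (2 * π)) := by
    ext x
    simp [cube]
  rw [hc]
  exact h3

/-! ### Characters and density of trigonometric polynomials -/

theorem continuous_torusChar {N : ℕ} (n : Fin N → ℤ) : Continuous (torusChar n) := by
  unfold torusChar
  fun_prop

theorem norm_torusChar {N : ℕ} (n : Fin N → ℤ) (x : Torus N) : ‖torusChar n x‖ = 1 := by
  simp only [torusChar, norm_prod, fourier_apply, Circle.norm_coe, Finset.prod_const_one]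

theorem torusChar_add {N : ℕ} (m n : Fin N → ℤ) (x : Torus N) :
    torusChar (m + n) x = torusChar m x * torusChar n x := by
  simp [torusChar, Finset.prod_mul_distrib]

theorem torusChar_covering {N : ℕ} (n : Fin N → ℤ) (x : Space N) :
    torusChar n (covering N x) =
      Complex.exp (Complex.I * ((⟪x, WithLp.toLp 2 (fun i => (n i : ℝ))⟫ : ℝ) : ℂ)) := by
  have h : ∀ i, fourier (n i) (covering N x i) =
      Complex.exp (Complex.I * ((n i * x i : ℝ) : ℂ)) := by
    intro i
    rw [covering, fourier_coe_apply]
    congr 1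
    have : (π : ℂ) ≠ 0 := by exact_mod_cast Real.pi_ne_zero
    push_cast
    field_simp
  simp only [torusChar, h, ← Complex.exp_sum, ← Finset.mul_sum, PiLp.inner_apply]
  congr 2
  push_cast
  simp

theorem integral_fourier_volume (k : ℤ) :
    ∫ x : AddCircle (2 * π), (fourier k x : ℂ) = if k = 0 then ((2 * π : ℝ) : ℂ) else 0 := by
  split_ifs with h
  · subst h
    simp [measureReal_def, AddCircle.measure_univ, Real.pi_pos.le]
  · exact integral_eq_zero_of_add_right_eq_neg (fourier_add_half_inv_index h Real.two_pi_pos)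

theorem integral_torusChar {N : ℕ} (n : Fin N → ℤ) :
    ∫ x : Torus N, torusChar n x = if n = 0 then ((2 * π : ℝ) : ℂ) ^ N else 0 := by
  simp only [torusChar]
  rw [integral_fintype_prod_volume_eq_prod (fun i (x : AddCircle (2 * π)) => (fourier (n i) x : ℂ))]
  simp only [integral_fourier_volume]
  split_ifs with h
  · subst h; simp
  · obtain ⟨i, hi⟩ := Function.ne_iff.mp h
    exact Finset.prod_eq_zero (Finset.mem_univ i) (if_neg hi)

/-- The trigonometric polynomial with the coefficients `c`. -/
def trigPoly {N : ℕ} (c : (Fin N → ℤ) →₀ ℂ) (x : Torus N) : ℂ :=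
  ∑ n ∈ c.support, c n * torusChar n x

theorem continuous_trigPoly {N : ℕ} (c : (Fin N → ℤ) →₀ ℂ) : Continuous (trigPoly c) :=
  continuous_finsetSum _ fun n _ => (continuous_torusChar n).const_mul _

theorem torusCoeff_trigPoly {N : ℕ} (c : (Fin N → ℤ) →₀ ℂ) (n : Fin N → ℤ) :
    torusCoeff (trigPoly c) n = c n := by
  have h : ∀ y : Torus N, trigPoly c y * torusChar (-n) y =
      ∑ m ∈ c.support, c m * torusChar (m - n) y := by
    intro y
    rw [trigPoly, Finset.sum_mul]
    refine Finset.sum_congr rfl fun m _ => ?_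
    rw [mul_assoc, ← torusChar_add, sub_eq_add_neg]
  have h2 : (((2 * π : ℝ) : ℂ)) ^ N ≠ 0 :=
    pow_ne_zero _ (by exact_mod_cast Real.two_pi_pos.ne')
  rw [torusCoeff]
  simp only [h]
  rw [integral_finsetSum]
  · simp only [integral_const_mul, integral_torusChar, sub_eq_zero, mul_ite, mul_zero]
    rw [Finset.sum_ite_eq']
    split_ifs with hn
    · rw [inv_pow]; field_simp
    · simp [Finsupp.notMem_support_iff.mp hn]
  · intro m _
    exact ((continuous_torusChar _).const_mul _).integrable_of_hasCompactSupport
      (HasCompactSupport.of_compactSpace _)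

/-- The characters as continuous functions. -/
def charMap {N : ℕ} (n : Fin N → ℤ) : C(Torus N, ℂ) := ⟨torusChar n, continuous_torusChar n⟩

/-- The algebra generated by the characters. -/
def charSubalgebra (N : ℕ) : StarSubalgebra ℂ C(Torus N, ℂ) where
  toSubalgebra := Algebra.adjoin ℂ (Set.range charMap)
  star_mem' := by
    change Algebra.adjoin ℂ (Set.range charMap) ≤ star (Algebra.adjoin ℂ (Set.range charMap))
    refine Algebra.adjoin_le ?_
    rintro _ ⟨n, rfl⟩
    refine Algebra.subset_adjoin ⟨-n, ?_⟩
    ext x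
    simp [charMap, torusChar]

/-- Products of characters are characters, so the generated algebra is already their linear span. -/
theorem charSubalgebra_coe (N : ℕ) :
    (charSubalgebra N).toSubalgebra.toSubmodule = Submodule.span ℂ (Set.range charMap) := by
  apply Algebra.adjoin_eq_span_of_subset
  refine .trans (fun x => Submonoid.closure_induction (fun _ => id) ⟨0, ?_⟩ ?_)
    Submodule.subset_span
  · ext z
    simp [charMap, torusChar]
  · rintro _ _ _ _ ⟨m, rfl⟩ ⟨n, rfl⟩
    exact ⟨m + n, by ext z; exact torusChar_add m n z⟩

theorem charSubalgebra_separatesPoints (N : ℕ) : (charSubalgebra N).SeparatesPoints := by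
  classical
  intro x y hxy
  obtain ⟨i, hi⟩ := Function.ne_iff.mp hxy
  refine ⟨_, ⟨charMap (Pi.single i 1), Algebra.subset_adjoin ⟨Pi.single i 1, rfl⟩, rfl⟩, ?_⟩
  have h : ∀ z : Torus N, charMap (Pi.single i 1) z = fourier 1 (z i) := by
    intro z
    change ∏ j, fourier ((Pi.single i 1 : Fin N → ℤ) j) (z j) = _
    rw [Finset.prod_eq_single i]
    · simp
    · intro j _ hj
      simp [Pi.single_eq_of_ne hj]
    · simp
  dsimp only
  rw [h, h, fourier_one, fourier_one]
  exact fun he => hi (AddCircle.injective_toCircle Real.two_pi_pos.ne' (Circle.coe_injective he))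

theorem exists_trigPoly_eq_of_mem_span {N : ℕ} {f : C(Torus N, ℂ)}
    (hf : f ∈ Submodule.span ℂ (Set.range (charMap (N := N)))) :
    ∃ c : (Fin N → ℤ) →₀ ℂ, ∀ x, f x = trigPoly c x := by
  obtain ⟨c, rfl⟩ := (Finsupp.mem_span_range_iff_exists_finsupp).mp hf
  refine ⟨c, fun x => ?_⟩
  simp [Finsupp.sum, trigPoly, ContinuousMap.sum_apply, charMap]

/-- Stone–Weierstrass for the star algebra of the characters. -/
theorem exists_trigPoly_norm_sub_lt {N : ℕ} (f : C(Torus N, ℂ)) {ε : ℝ} (hε : 0 < ε) :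
    ∃ c : (Fin N → ℤ) →₀ ℂ, ∀ x, ‖f x - trigPoly c x‖ < ε := by
  have h : f ∈ (charSubalgebra N).topologicalClosure := by
    rw [ContinuousMap.starSubalgebra_topologicalClosure_eq_top_of_separatesPoints _
      (charSubalgebra_separatesPoints N)]
    trivial
  have h' : f ∈ closure (charSubalgebra N : Set C(Torus N, ℂ)) := h
  obtain ⟨g, hg, hfg⟩ := Metric.mem_closure_iff.mp h' ε hε
  have hg' : g ∈ (charSubalgebra N).toSubalgebra.toSubmodule := hg
  rw [charSubalgebra_coe] at hg'
  obtain ⟨c, hc⟩ := exists_trigPoly_eq_of_mem_span hg'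
  refine ⟨c, fun x => ?_⟩
  rw [← hc, ← dist_eq_norm]
  exact (ContinuousMap.dist_apply_le_dist x).trans_lt hfg

/-- Continuous functions are dense in `L_p`, and on a space of finite measure uniform approximation
controls the `L_p` norm. -/
theorem exists_trigPoly_eLpNorm_sub_le {N : ℕ} {p : ℝ≥0∞} (hp' : p ≠ ∞)
    {G : Torus N → ℂ} (hG : MemLp G p volume) {ε : ℝ≥0∞} (hε : ε ≠ 0) :
    ∃ c : (Fin N → ℤ) →₀ ℂ, eLpNorm (fun x => G x - trigPoly c x) p volume ≤ ε := by
  obtain ⟨δ, hδ0, hδ⟩ := exists_Lp_half ℂ (volume : Measure (Torus N)) p hε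
  obtain ⟨g, hg, -⟩ := hG.exists_boundedContinuous_eLpNorm_sub_le hp' hδ0.ne'
  obtain ⟨η, hη0, hη⟩ : ∃ η : ℝ≥0, 0 < η ∧
      (volume : Measure (Torus N)) Set.univ ^ p.toReal⁻¹ * η ≤ δ := by
    have h : (volume : Measure (Torus N)) Set.univ ^ p.toReal⁻¹ ≠ ∞ :=
      ENNReal.rpow_ne_top_of_nonneg (by positivity) (measure_ne_top _ _)
    obtain ⟨η, hη, h1⟩ := ENNReal.exists_nnreal_pos_mul_lt h hδ0.ne'
    exact ⟨η, hη, by rw [mul_comm]; exact h1.le⟩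
  obtain ⟨c, hc⟩ := exists_trigPoly_norm_sub_lt (ε := η) g.toContinuousMap (by exact_mod_cast hη0)
  refine ⟨c, ?_⟩
  have h2 : eLpNorm (fun x => g x - trigPoly c x) p volume ≤ δ := by
    refine (eLpNorm_le_of_ae_bound (C := (η : ℝ)) (Filter.Eventually.of_forall fun x =>
      (hc x).le)).trans ?_
    simpa using hη
  have h3 := (hδ (fun x => G x - g x) (fun x => g x - trigPoly c x)
    (hG.1.sub g.continuous.aestronglyMeasurable)
    (g.continuous.sub (continuous_trigPoly c)).aestronglyMeasurable hg h2).le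
  have h4 : (fun x => G x - trigPoly c x) =
      (fun x => G x - g x) + fun x => g x - trigPoly c x :=
    funext fun x => (sub_add_sub_cancel (G x) (g x) (trigPoly c x)).symm
  rw [h4]
  exact h3

/-! ### Partial sums and reduction to half-integer radii -/

theorem partialSum_trigPoly {N : ℕ} (a r : ℝ) (c : (Fin N → ℤ) →₀ ℂ) (x : Torus N) :
    partialSum a r (trigPoly c) x = ∑ n ∈ c.support,
      c n * ((if latticeNormSq n < r then (1 + latticeNormSq n) ^ (-a / 2) else 0 : ℝ) *
        torusChar n x) := by
  classical
  simp only [partialSum, torusCoeff_trigPoly]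
  have h : ∀ n, (n ∈ latticeBall N r) ↔ latticeNormSq n < r := by
    simp [latticeBall]
  simp only [← h, apply_ite (Complex.ofReal), ite_mul, mul_ite, Complex.ofReal_zero, zero_mul,
    mul_zero, ← Finset.sum_filter]
  rw [← Finset.sum_filter_add_sum_filter_not (latticeBall N r) (fun n => n ∈ c.support)]
  rw [Finset.sum_eq_zero (s := (latticeBall N r).filter (fun n => ¬ n ∈ c.support)), add_zero]
  · refine Finset.sum_congr ?_ fun n _ => by ring
    ext n; simp [and_comm]
  · intro n hn
    simp [Finsupp.notMem_support_iff.mp (Finset.mem_filter.mp hn).2]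

theorem partialSum_sub {N : ℕ} (a r : ℝ) {F G : Torus N → ℂ} (hF : Integrable F)
    (hG : Integrable G) (x : Torus N) :
    partialSum a r (fun y => F y - G y) x = partialSum a r F x - partialSum a r G x := by
  have hb : ∀ {F : Torus N → ℂ}, Integrable F → ∀ n, Integrable (fun y => F y * torusChar n y) :=
    fun hF n => hF.mul_bdd (c := 1) (continuous_torusChar n).aestronglyMeasurable
      (Filter.Eventually.of_forall fun y => (norm_torusChar n y).le)
  simp only [partialSum, torusCoeff, sub_mul, ← Finset.sum_sub_distrib]
  refine Finset.sum_congr rfl fun n _ => ?_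
  rw [integral_sub (hb hF _) (hb hG _)]
  ring

theorem continuous_partialSum {N : ℕ} (a r : ℝ) (G : Torus N → ℂ) :
    Continuous (partialSum a r G) :=
  continuous_finsetSum _ fun n _ => (continuous_torusChar n).const_mul _

/-- A crude bound, by Hölder on each of the finitely many coefficients. The constant depends on `r`;
it serves only to replace `G` by a polynomial once the radii are fixed. -/
theorem exists_enorm_partialSum_le (N : ℕ) (a r : ℝ) {p : ℝ≥0∞} (hp : 1 ≤ p) :
    ∃ C : ℝ≥0, ∀ F : Torus N → ℂ, MemLp F p volume → ∀ x,
      ‖partialSum a r F x‖ₑ ≤ C * eLpNorm F p volume := by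
  set V : ℝ≥0∞ := (volume : Measure (Torus N)) Set.univ ^ (1 / (1 : ℝ≥0∞).toReal - 1 / p.toReal)
    with hV
  set w : (Fin N → ℤ) → ℝ≥0∞ := fun n =>
    ‖(((1 + latticeNormSq n) ^ (-a / 2) : ℝ) : ℂ)‖ₑ * ‖((2 * π : ℝ) : ℂ)⁻¹ ^ N‖ₑ with hw
  have hVt : V ≠ ∞ := by
    by_cases h0 : (volume : Measure (Torus N)) Set.univ = 0
    · have := (Measure.measure_univ_ne_zero (μ := (volume : Measure (Torus N)))).mpr
        (NeZero.ne _)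
      exact absurd h0 this
    · exact ENNReal.rpow_ne_top_of_ne_zero h0 (measure_ne_top _ _)
  have hwt : ∑ n ∈ latticeBall N r, w n ≠ ∞ :=
    ENNReal.sum_ne_top.mpr fun n _ => ENNReal.mul_ne_top enorm_ne_top enorm_ne_top
  refine ⟨((∑ n ∈ latticeBall N r, w n) * V).toNNReal, fun F hF x => ?_⟩
  rw [ENNReal.coe_toNNReal (ENNReal.mul_ne_top hwt hVt)]
  have h1 : ∀ n, ‖∫ y : Torus N, F y * torusChar n y‖ₑ ≤ V * eLpNorm F p volume := by
    intro n
    refine (enorm_integral_le_lintegral_enorm _).trans ?_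
    have : ∀ y, ‖F y * torusChar n y‖ₑ = ‖F y‖ₑ := by
      intro y
      rw [enorm_mul, ← ofReal_norm (torusChar n y), norm_torusChar]
      simp
    simp only [this]
    rw [← eLpNorm_one_eq_lintegral_enorm, mul_comm V]
    exact eLpNorm_le_eLpNorm_mul_rpow_measure_univ hp hF.1
  rw [mul_assoc, Finset.sum_mul]
  refine (enorm_sum_le _ _).trans (Finset.sum_le_sum fun n _ => ?_)
  rw [torusCoeff, enorm_mul, enorm_mul, enorm_mul, ← ofReal_norm (torusChar n x), norm_torusChar,
    ENNReal.ofReal_one, mul_one, hw, mul_assoc]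
  gcongr
  exact h1 _

/-- As `|n|²` is a natural number, `|n|² < r` means `|n|² ≤ ⌈r⌉₊ - 1`, and adding 1/2 to this bound
admits no further integer. -/
theorem latticeBall_eq {N : ℕ} {r : ℝ} (hr : 0 < r) :
    latticeBall N r = latticeBall N (((⌈r⌉₊ - 1 : ℕ) : ℝ) + 1 / 2) := by
  ext n
  simp only [latticeBall, Set.Finite.mem_toFinset]
  change latticeNormSq n < r ↔ latticeNormSq n < _
  obtain ⟨s, hs⟩ : ∃ s : ℕ, latticeNormSq n = s := by
    refine ⟨∑ i, (n i).natAbs ^ 2, ?_⟩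
    simp [latticeNormSq, Nat.cast_natAbs]
  rw [hs, ← Nat.lt_ceil]
  have h1 : 0 < ⌈r⌉₊ := Nat.ceil_pos.mpr hr
  generalize ⌈r⌉₊ = t at h1
  obtain ⟨t, rfl⟩ := Nat.exists_eq_succ_of_ne_zero h1.ne'
  simp only [Nat.succ_eq_add_one, Nat.add_sub_cancel]
  constructor
  · intro h
    have : (s : ℝ) ≤ t := by exact_mod_cast Nat.lt_succ_iff.mp h
    linarith
  · intro h
    have : (s : ℝ) < ((t + 1 : ℕ) : ℝ) := by push_cast; linarith
    exact_mod_cast this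

/-- The maximum of the first `K` distinct spherical partial sums. -/
def truncatedSum {N : ℕ} (a : ℝ) (K : ℕ) (G : Torus N → ℂ) (x : Torus N) : ℝ≥0∞ :=
  (Finset.range K).sup fun k => ‖partialSum a ((k : ℝ) + 1 / 2) G x‖ₑ

theorem measurable_truncatedSum {N : ℕ} (a : ℝ) (K : ℕ) (G : Torus N → ℂ) :
    Measurable (truncatedSum a K G) := by
  unfold truncatedSum
  simp only [Finset.sup_eq_iSup]
  exact Measurable.iSup fun k => Measurable.iSup fun _ =>
    (continuous_partialSum a _ G).enorm.measurable

theorem maximalSum_eq_iSup {N : ℕ} (a : ℝ) (G : Torus N → ℂ) (x : Torus N) :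
    maximalSum a G x = ⨆ K, truncatedSum a K G x := by
  apply le_antisymm
  · refine iSup₂_le fun r hr => ?_
    refine le_trans ?_ (le_iSup _ (⌈r⌉₊ - 1 + 1))
    rw [show partialSum a r G x = partialSum a (((⌈r⌉₊ - 1 : ℕ) : ℝ) + 1 / 2) G x by
      rw [partialSum, partialSum, ← latticeBall_eq hr]]
    exact Finset.le_sup (f := fun k : ℕ => ‖partialSum a ((k : ℝ) + 1 / 2) G x‖ₑ)
      (Finset.self_mem_range_succ _)
  · refine iSup_le fun K => Finset.sup_le fun k _ => ?_
    exact le_iSup₂_of_le ((k : ℝ) + 1 / 2) (by positivity) le_rfl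

theorem truncatedSum_mono {N : ℕ} (a : ℝ) (G : Torus N → ℂ) (x : Torus N) :
    Monotone fun K => truncatedSum a K G x :=
  fun _ _ h => Finset.sup_mono (Finset.range_mono h)

theorem exists_truncatedSum_le (N : ℕ) (a : ℝ) (K : ℕ) {p : ℝ≥0∞} (hp : 1 ≤ p) :
    ∃ C : ℝ≥0, ∀ F G : Torus N → ℂ, MemLp F p volume → MemLp G p volume → ∀ x,
      truncatedSum a K F x ≤
        truncatedSum a K G x + C * eLpNorm (fun y => F y - G y) p volume := by
  choose C hC using fun k : ℕ => exists_enorm_partialSum_le N a ((k : ℝ) + 1 / 2) hp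
  refine ⟨∑ k ∈ Finset.range K, C k, fun F G hF hG x => Finset.sup_le fun k hk => ?_⟩
  have h1 : partialSum a ((k : ℝ) + 1 / 2) F x = partialSum a ((k : ℝ) + 1 / 2) G x +
      partialSum a ((k : ℝ) + 1 / 2) (fun y => F y - G y) x := by
    rw [partialSum_sub a _ (hF.integrable hp) (hG.integrable hp)]
    ring
  rw [h1]
  refine (enorm_add_le _ _).trans (add_le_add ?_ ?_)
  · exact Finset.le_sup (f := fun k : ℕ => ‖partialSum a ((k : ℝ) + 1 / 2) G x‖ₑ) hk
  · refine (hC k _ (hF.sub hG) x).trans ?_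
    refine mul_le_mul_left (ENNReal.coe_le_coe.mpr ?_) _
    exact Finset.single_le_sum (f := C) (fun _ _ => zero_le) hk

/-! ### The multiplier on wave packets in the Euclidean space -/

open scoped FourierTransform

variable {N : ℕ}

/-- The multiplier of the spherical partial integrals. -/
def symbol (a r : ℝ) (ξ : Space N) : ℝ :=
  if ‖ξ‖ ^ 2 < r then (1 + ‖ξ‖ ^ 2) ^ (-a / 2) else 0

/-- The normalizing factor of the unitary Fourier transform. -/
def unitaryFactor (N : ℕ) : ℝ := (2 * π) ^ (-(N : ℝ) / 2)

theorem unitaryFactor_pos (N : ℕ) : 0 < unitaryFactor N := Real.rpow_pos_of_pos Real.two_pi_pos _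

theorem unitaryFactor_mul_self (N : ℕ) : unitaryFactor N * unitaryFactor N * (2 * π) ^ N = 1 := by
  have h := Real.two_pi_pos
  rw [unitaryFactor, ← Real.rpow_add h, ← Real.rpow_natCast, ← Real.rpow_add h]
  convert Real.rpow_zero (2 * π) using 2
  ring

theorem measurable_symbol (a r : ℝ) : Measurable (symbol a r : Space N → ℝ) := by
  refine Measurable.ite (measurableSet_lt (by fun_prop) measurable_const) ?_ measurable_const
  exact (measurable_const.add (measurable_norm.pow_const 2)).pow_const _

theorem norm_symbol_le (a r : ℝ) (ξ : Space N) : ‖symbol a r ξ‖ ≤ (1 + |r|) ^ |(-a / 2)| := by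
  have h0 : 1 ≤ 1 + ‖ξ‖ ^ 2 := by nlinarith [sq_nonneg ‖ξ‖]
  unfold symbol
  split_ifs with h
  · rw [Real.norm_of_nonneg (by positivity)]
    -- The sign of `a` is arbitrary; passing to the absolute value of the exponent makes the power
    -- increasing in the base.
    calc (1 + ‖ξ‖ ^ 2) ^ (-a / 2) ≤ (1 + ‖ξ‖ ^ 2) ^ |(-a / 2)| :=
          Real.rpow_le_rpow_of_exponent_le h0 (le_abs_self _)
      _ ≤ _ := Real.rpow_le_rpow (by positivity) (by linarith [le_abs_self r]) (abs_nonneg _)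
  · rw [norm_zero]; positivity

theorem continuousAt_symbol (a : ℝ) {r : ℝ} {ξ : Space N} (h : ‖ξ‖ ^ 2 ≠ r) :
    ContinuousAt (symbol a r) ξ := by
  have hc : Continuous fun x : Space N => ‖x‖ ^ 2 := by fun_prop
  rcases lt_or_gt_of_ne h with h | h
  · have h1 : ContinuousAt (fun x : Space N => (1 + ‖x‖ ^ 2) ^ (-a / 2)) ξ :=
      ContinuousAt.rpow_const (continuous_const.add hc).continuousAt (Or.inl (by positivity))
    refine h1.congr ?_
    filter_upwards [(isOpen_lt hc continuous_const).mem_nhds h] with x hx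
    exact (if_pos hx).symm
  · refine (continuousAt_const (y := (0 : ℝ))).congr ?_
    filter_upwards [(isOpen_lt continuous_const hc).mem_nhds h] with x hx
    exact (if_neg (not_lt.mpr (le_of_lt hx))).symm

theorem partialIntegral_eq_integral_symbol (a r : ℝ) (g : Space N → ℂ) (x : Space N) :
    partialIntegral a r g x = unitaryFactor N * ∫ ξ : Space N,
      (symbol a r ξ : ℂ) * fourierT g ξ * Complex.exp (Complex.I * ((⟪x, ξ⟫ : ℝ) : ℂ)) := by
  rw [partialIntegral, ← integral_indicator
    (measurableSet_lt (by fun_prop) measurable_const)]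
  congr 2
  ext ξ
  by_cases h : ‖ξ‖ ^ 2 < r
  · rw [Set.indicator_of_mem (by exact h), symbol, if_pos h]
  · rw [Set.indicator_of_notMem (by exact h), symbol, if_neg h]
    simp

theorem norm_exp_I_mul_ofReal (t : ℝ) : ‖Complex.exp (Complex.I * (t : ℂ))‖ = 1 := by
  rw [mul_comm, Complex.norm_exp_ofReal_mul_I]

theorem fourierT_eq_fourier (g : Space N → ℂ) (ξ : Space N) :
    fourierT g ξ = unitaryFactor N * 𝓕 g ((2 * π)⁻¹ • ξ) := by
  rw [fourierT, Real.fourier_eq', unitaryFactor]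
  congr 2
  ext x
  rw [smul_eq_mul, mul_comm]
  congr 2
  rw [inner_smul_right]
  have : (π : ℂ) ≠ 0 := by exact_mod_cast Real.pi_ne_zero
  push_cast
  field_simp

theorem integrable_fourierT (φ : 𝓢(Space N, ℂ)) : Integrable (fourierT φ) := by
  have h1 : Integrable (fun ξ : Space N => 𝓕 (φ : Space N → ℂ) ξ) := (𝓕 φ).integrable
  have h2 := (h1.comp_smul (R := (2 * π)⁻¹) (by positivity)).const_mul (unitaryFactor N : ℂ)
  exact h2.congr (Filter.Eventually.of_forall fun ξ => (fourierT_eq_fourier _ _).symm)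

theorem fourierT_inversion (φ : 𝓢(Space N, ℂ)) (y : Space N) :
    φ y = unitaryFactor N * ∫ ξ : Space N,
      fourierT φ ξ * Complex.exp (Complex.I * ((⟪y, ξ⟫ : ℝ) : ℂ)) := by
  have h1 : φ y = ∫ v : Space N,
      Complex.exp (((2 * π * ⟪v, y⟫ : ℝ) : ℂ) * Complex.I) • 𝓕 (φ : Space N → ℂ) v := by
    rw [← Real.fourierInv_eq', φ.continuous.fourierInv_fourier_eq φ.integrable (𝓕 φ).integrable]
  have h2 := Measure.integral_comp_inv_smul_of_nonneg (volume : Measure (Space N))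
    (fun v : Space N => Complex.exp (((2 * π * ⟪v, y⟫ : ℝ) : ℂ) * Complex.I) •
      𝓕 (φ : Space N → ℂ) v) (R := 2 * π) Real.two_pi_pos.le
  rw [← h1, finrank_euclideanSpace_fin] at h2
  have h3 : ∀ ξ : Space N, fourierT φ ξ * Complex.exp (Complex.I * ((⟪y, ξ⟫ : ℝ) : ℂ)) =
      unitaryFactor N * (Complex.exp (((2 * π * ⟪(2 * π)⁻¹ • ξ, y⟫ : ℝ) : ℂ) * Complex.I) •
        𝓕 (φ : Space N → ℂ) ((2 * π)⁻¹ • ξ)) := by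
    intro ξ
    rw [fourierT_eq_fourier, real_inner_smul_left, mul_inv_cancel_left₀ Real.two_pi_pos.ne',
      real_inner_comm, smul_eq_mul, mul_comm Complex.I]
    ring
  simp only [h3]
  rw [integral_const_mul, h2, Complex.real_smul, ← mul_assoc, ← mul_assoc]
  have := unitaryFactor_mul_self N
  rw [← Complex.ofReal_mul, ← Complex.ofReal_mul, this, Complex.ofReal_one, one_mul]

theorem fourierT_modulate_dilate (φ g : Space N → ℂ) (v : Space N) {M : ℝ} (hM : 0 < M)
    (hg : ∀ x, g x = Complex.exp (Complex.I * ((⟪x, v⟫ : ℝ) : ℂ)) * φ (M⁻¹ • x))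
    (ξ : Space N) : fourierT g ξ = (M ^ N : ℝ) * fourierT φ (M • (ξ - v)) := by
  have h2 := Measure.integral_comp_inv_smul_of_nonneg (volume : Measure (Space N))
    (fun x : Space N => φ x * Complex.exp (-(Complex.I * ((⟪x, M • (ξ - v)⟫ : ℝ) : ℂ))))
    (R := M) hM.le
  rw [finrank_euclideanSpace_fin, Complex.real_smul] at h2
  rw [fourierT, fourierT, mul_left_comm, ← h2]
  congr 2
  ext x
  rw [hg, real_inner_smul_left, real_inner_smul_right, inv_mul_cancel_left₀ hM.ne', inner_sub_right,
    mul_right_comm, ← Complex.exp_add, mul_comm]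
  congr 2
  push_cast
  ring

/-- The substitution `ξ = v + η / M` moves the dependence on `v` and `M` in frequency from the
transform into the argument of the symbol. -/
theorem partialIntegral_modulate_dilate (a r : ℝ) (φ g : Space N → ℂ) (v : Space N) {M : ℝ}
    (hM : 0 < M)
    (hg : ∀ x, g x = Complex.exp (Complex.I * ((⟪x, v⟫ : ℝ) : ℂ)) * φ (M⁻¹ • x)) (x : Space N) :
    partialIntegral a r g x = Complex.exp (Complex.I * ((⟪x, v⟫ : ℝ) : ℂ)) *
      (unitaryFactor N * ∫ η : Space N, (symbol a r (v + M⁻¹ • η) : ℂ) * fourierT φ η *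
        Complex.exp (Complex.I * ((⟪M⁻¹ • x, η⟫ : ℝ) : ℂ))) := by
  have h2 := Measure.integral_comp_smul_of_nonneg (volume : Measure (Space N))
    (fun η : Space N => (symbol a r (v + M⁻¹ • η) : ℂ) * fourierT φ η *
        Complex.exp (Complex.I * ((⟪M⁻¹ • x, η⟫ : ℝ) : ℂ))) M (hR := hM.le)
  rw [finrank_euclideanSpace_fin, Complex.real_smul] at h2
  have h3 : ∫ ξ : Space N, (symbol a r ξ : ℂ) * fourierT g ξ *
      Complex.exp (Complex.I * ((⟪x, ξ⟫ : ℝ) : ℂ)) =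
      Complex.exp (Complex.I * ((⟪x, v⟫ : ℝ) : ℂ)) * ((M ^ N : ℝ) * ∫ η : Space N,
        (symbol a r (v + M⁻¹ • M • η) : ℂ) * fourierT φ (M • η) *
          Complex.exp (Complex.I * ((⟪M⁻¹ • x, M • η⟫ : ℝ) : ℂ))) := by
    rw [← integral_add_left_eq_self _ v, ← integral_const_mul, ← integral_const_mul]
    congr 1
    ext η
    rw [fourierT_modulate_dilate φ g v hM hg, add_sub_cancel_left, inner_add_right,
      inv_smul_smul₀ hM.ne', real_inner_smul_left, real_inner_smul_right,
      inv_mul_cancel_left₀ hM.ne', Complex.ofReal_add, mul_add, Complex.exp_add]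
    ring
  have h4 : ((M ^ N : ℝ) : ℂ) * (((M ^ N)⁻¹ : ℝ) : ℂ) = 1 := by
    rw [← Complex.ofReal_mul, mul_inv_cancel₀ (pow_pos hM N).ne', Complex.ofReal_one]
  rw [partialIntegral_eq_integral_symbol, h3, h2, ← mul_assoc ((M ^ N : ℝ) : ℂ), h4]
  ring

/-- The error of the partial integral of a dilated and modulated Schwartz function. -/
def symbolError (a r : ℝ) (φ : Space N → ℂ) (v : Space N) (M : ℝ) : ℝ :=
  unitaryFactor N * ∫ η : Space N, ‖symbol a r (v + M⁻¹ • η) - symbol a r v‖ * ‖fourierT φ η‖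

theorem integrable_symbol_mul (a r : ℝ) {f : Space N → ℂ} (hf : Integrable f) (v : Space N)
    (M : ℝ) (y : Space N) : Integrable fun η : Space N => (symbol a r (v + M⁻¹ • η) : ℂ) * f η *
        Complex.exp (Complex.I * ((⟪y, η⟫ : ℝ) : ℂ)) := by
  refine Integrable.mul_bdd (c := 1) ?_ ?_
    (Filter.Eventually.of_forall fun η => (norm_exp_I_mul_ofReal _).le)
  · refine hf.bdd_mul (c := (1 + |r|) ^ |(-a / 2)|) ?_
      (Filter.Eventually.of_forall fun η => ?_)
    · exact (Complex.measurable_ofReal.comp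
        ((measurable_symbol a r).comp (by fun_prop))).aestronglyMeasurable
    · rw [Complex.norm_real]
      exact norm_symbol_le a r _
  · exact Continuous.aestronglyMeasurable (by fun_prop)

/-- By Fourier inversion `symbol a r v * g x` is the same integral with the symbol frozen at `v`.
The exponentials have modulus 1, so the bound for the difference does not depend on `x`. -/
theorem norm_partialIntegral_sub_le (a r : ℝ) (φ : 𝓢(Space N, ℂ)) (g : Space N → ℂ)
    (v : Space N) {M : ℝ} (hM : 0 < M)
    (hg : ∀ x, g x = Complex.exp (Complex.I * ((⟪x, v⟫ : ℝ) : ℂ)) * φ (M⁻¹ • x)) (x : Space N) :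
    ‖partialIntegral a r g x - symbol a r v * g x‖ ≤ symbolError a r φ v M := by
  rw [partialIntegral_modulate_dilate a r φ g v hM hg, hg, fourierT_inversion φ (M⁻¹ • x)]
  have h : ∀ A B c e s : ℂ, e * (c * A) - s * (e * (c * B)) = e * (c * (A - s * B)) := by
    intros; ring
  rw [h, norm_mul, norm_exp_I_mul_ofReal, one_mul, norm_mul, Complex.norm_real,
    Real.norm_of_nonneg (unitaryFactor_pos N).le, symbolError]
  refine mul_le_mul_of_nonneg_left ?_ (unitaryFactor_pos N).le
  have h1 : Integrable fun η : Space N =>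
      fourierT φ η * Complex.exp (Complex.I * ((⟪M⁻¹ • x, η⟫ : ℝ) : ℂ)) :=
    (integrable_fourierT φ).mul_bdd (c := 1) (Continuous.aestronglyMeasurable (by fun_prop))
      (Filter.Eventually.of_forall fun η => (norm_exp_I_mul_ofReal _).le)
  rw [← integral_const_mul, ← integral_sub
    (integrable_symbol_mul a r (integrable_fourierT φ) v M _) (h1.const_mul _)]
  refine (norm_integral_le_integral_norm _).trans (le_of_eq ?_)
  congr 1
  ext η
  rw [← mul_assoc, ← sub_mul, ← sub_mul, norm_mul, norm_mul, norm_exp_I_mul_ofReal, mul_one,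
    ← Complex.ofReal_sub, Complex.norm_real]

/-- Dominated convergence: `v + η / M` tends to `v`, a continuity point of the bounded symbol, and
the transform of `φ` is integrable. -/
theorem tendsto_symbolError (a : ℝ) {r : ℝ} (φ : 𝓢(Space N, ℂ)) {v : Space N}
    (hv : ‖v‖ ^ 2 ≠ r) :
    Filter.Tendsto (fun M : ℕ => symbolError a r φ v M) Filter.atTop (nhds 0) := by
  rw [← mul_zero (unitaryFactor N)]
  refine Filter.Tendsto.const_mul _ ?_
  rw [← integral_zero (Space N) ℝ (μ := volume)]
  set B := (1 + |r|) ^ |(-a / 2)|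
  refine tendsto_integral_of_dominated_convergence (fun η => (B + B) * ‖fourierT φ η‖) ?_
    ((integrable_fourierT φ).norm.const_mul _) ?_ ?_
  · intro M
    refine AEStronglyMeasurable.mul ?_ (integrable_fourierT φ).norm.1
    exact ((((measurable_symbol a r).comp (by fun_prop)).sub
      measurable_const).norm).aestronglyMeasurable
  · refine fun M => Filter.Eventually.of_forall fun η => ?_
    rw [norm_mul, norm_norm, norm_norm]
    refine mul_le_mul_of_nonneg_right ?_ (norm_nonneg _)
    exact (norm_sub_le _ _).trans (add_le_add (norm_symbol_le _ _ _) (norm_symbol_le _ _ _))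
  · refine Filter.Eventually.of_forall fun η => ?_
    have h1 : Filter.Tendsto (fun M : ℕ => v + (M : ℝ)⁻¹ • η) Filter.atTop (nhds v) := by
      have := (tendsto_inv_atTop_nhds_zero_nat (𝕜 := ℝ)).smul_const η
      simpa using this.const_add v
    have h2 := (((continuousAt_symbol a hv).tendsto.comp h1).sub_const (symbol a r v)).norm
    simpa using h2.mul_const ‖fourierT φ η‖

theorem partialIntegral_sum {ι : Type*} (a r : ℝ) (s : Finset ι) (c : ι → ℂ)
    (g : ι → 𝓢(Space N, ℂ)) (x : Space N) :
    partialIntegral a r (fun y => ∑ n ∈ s, c n * g n y) x =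
      ∑ n ∈ s, c n * partialIntegral a r (g n) x := by
  have h1 : ∀ ξ, fourierT (fun y => ∑ n ∈ s, c n * g n y) ξ =
      ∑ n ∈ s, c n * fourierT (g n) ξ := by
    intro ξ
    simp only [fourierT, Finset.sum_mul, mul_assoc]
    rw [integral_finsetSum, Finset.mul_sum]
    · simp only [integral_const_mul]
      exact Finset.sum_congr rfl fun n _ => by ring
    · intro n _
      refine Integrable.const_mul ((g n).integrable.mul_bdd (c := 1)
        (Continuous.aestronglyMeasurable (by fun_prop))
        (Filter.Eventually.of_forall fun η => ?_)) _
      rw [Complex.norm_exp]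
      simp
  simp only [partialIntegral_eq_integral_symbol, h1, Finset.mul_sum, Finset.sum_mul]
  rw [integral_finsetSum, Finset.mul_sum]
  · refine Finset.sum_congr rfl fun n _ => ?_
    rw [← integral_const_mul, ← integral_const_mul, ← integral_const_mul]
    congr 1
    ext ξ
    ring
  · intro n _
    have := (integrable_symbol_mul a r (integrable_fourierT (g n)) 0 1 x).const_mul (c n)
    refine this.congr (Filter.Eventually.of_forall fun ξ => ?_)
    simp only [inv_one, one_smul, zero_add]
    ring

/-! ### Cut-off polynomials and comparison with partial sums -/

/-- The lattice point `n` as a vector of the Euclidean space. -/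
def latticeVec (n : Fin N → ℤ) : Space N := WithLp.toLp 2 fun i => (n i : ℝ)

theorem norm_latticeVec_sq (n : Fin N → ℤ) : ‖latticeVec n‖ ^ 2 = latticeNormSq n := by
  simp [EuclideanSpace.norm_sq_eq, latticeVec, latticeNormSq]

theorem latticeNormSq_ne (n : Fin N → ℤ) (k : ℕ) : latticeNormSq n ≠ (k : ℝ) + 1 / 2 := by
  intro h
  have h1 : ((2 * ∑ i, (n i) ^ 2 : ℤ) : ℝ) = ((2 * k + 1 : ℤ) : ℝ) := by
    push_cast
    rw [latticeNormSq] at h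
    rw [h]
    ring
  have h2 : 2 * ∑ i, (n i) ^ 2 = 2 * (k : ℤ) + 1 := by exact_mod_cast h1
  omega

/-- A smooth bump that is `1` on the ball of radius `2π(N+1)`. -/
def bump (N : ℕ) : ContDiffBump (0 : Space N) where
  -- A point of `[0, 2π]^N` has norm at most `2π√N`, hence lies in the inner ball; `N + 1` keeps the
  -- radius positive for `N = 0`. The outer ball fits into a cube of side `8π(N+1)`, that is,
  -- `4(N+1)` periods.
  rIn := 2 * π * (N + 1)
  rOut := 4 * π * (N + 1)
  rIn_pos := by positivity
  rIn_lt_rOut := by nlinarith [Real.pi_pos, (Nat.cast_nonneg N : (0 : ℝ) ≤ N)]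

theorem hasCompactSupport_ofReal_bump (N : ℕ) :
    HasCompactSupport fun x : Space N => (bump N x : ℂ) :=
  (bump N).hasCompactSupport.comp_left Complex.ofReal_zero

theorem contDiff_ofReal_bump (N : ℕ) {n : ℕ∞} : ContDiff ℝ n fun x : Space N => (bump N x : ℂ) :=
  Complex.ofRealCLM.contDiff.comp (bump N).contDiff

/-- The bump as a Schwartz function. -/
def schwartzBump (N : ℕ) : 𝓢(Space N, ℂ) :=
  (hasCompactSupport_ofReal_bump N).toSchwartzMap (contDiff_ofReal_bump N)

/-- The dilated bump times a character. -/
def wavePacket (n : Fin N → ℤ) {M : ℕ} (hM : 0 < M) : 𝓢(Space N, ℂ) :=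
  HasCompactSupport.toSchwartzMap
    (f := fun x => Complex.exp (Complex.I * ((⟪x, latticeVec n⟫ : ℝ) : ℂ)) *
      (bump N ((M : ℝ)⁻¹ • x) : ℂ))
    (((hasCompactSupport_ofReal_bump N).comp_smul (by positivity)).mul_left)
    (by
      refine ContDiff.mul ?_ ((contDiff_ofReal_bump N).comp (contDiff_const_smul _))
      refine ContDiff.cexp (contDiff_const.mul ?_)
      exact Complex.ofRealCLM.contDiff.comp (contDiff_id.inner ℝ contDiff_const))

theorem wavePacket_eq (n : Fin N → ℤ) {M : ℕ} (hM : 0 < M) (x : Space N) :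
    wavePacket n hM x = Complex.exp (Complex.I * ((⟪x, latticeVec n⟫ : ℝ) : ℂ)) *
      schwartzBump N ((M : ℝ)⁻¹ • x) := rfl

theorem wavePacket_apply (n : Fin N → ℤ) {M : ℕ} (hM : 0 < M) (x : Space N) :
    wavePacket n hM x = torusChar n (covering N x) * (bump N ((M : ℝ)⁻¹ • x) : ℂ) := by
  rw [torusChar_covering]
  rfl

theorem bump_eq_one {M : ℕ} (hM : 0 < M) {x : Space N} (hx : x ∈ cube N 0 M) :
    bump N ((M : ℝ)⁻¹ • x) = 1 := by
  have hM' : (0 : ℝ) < M := by exact_mod_cast hM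
  refine (bump N).one_of_mem_closedBall ?_
  rw [mem_closedBall_zero_iff]
  change _ ≤ 2 * π * (N + 1)
  refine abs_le_of_sq_le_sq' ?_ (by positivity) |>.2
  rw [EuclideanSpace.norm_sq_eq]
  calc ∑ i, ‖((M : ℝ)⁻¹ • x) i‖ ^ 2 ≤ ∑ _i : Fin N, (2 * π) ^ 2 := by
        refine Finset.sum_le_sum fun i _ => ?_
        have h := hx i
        rw [zero_add] at h
        rw [PiLp.smul_apply, smul_eq_mul, Real.norm_of_nonneg (mul_nonneg (by positivity) h.1.le)]
        refine pow_le_pow_left₀ (mul_nonneg (by positivity) h.1.le) ?_ 2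
        rw [inv_mul_le_iff₀ hM']
        exact h.2
    _ = N * (2 * π) ^ 2 := by simp
    _ ≤ (2 * π * (N + 1)) ^ 2 := by
        rw [mul_pow (2 * π) ((N : ℝ) + 1), mul_comm (N : ℝ)]
        refine mul_le_mul_of_nonneg_left ?_ (sq_nonneg _)
        nlinarith [(Nat.cast_nonneg N : (0 : ℝ) ≤ N)]

theorem bump_eq_zero {M : ℕ} (hM : 0 < M) {x : Space N}
    (hx : x ∉ cube N (-(4 * π * (N + 1) * M)) (4 * (N + 1) * M)) :
    bump N ((M : ℝ)⁻¹ • x) = 0 := by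
  have hM' : (0 : ℝ) < M := by exact_mod_cast hM
  refine (bump N).zero_of_le_dist ?_
  rw [dist_zero_right]
  change 4 * π * (N + 1) ≤ _
  simp only [cube, Set.mem_ofPred_eq, not_forall] at hx
  obtain ⟨i, hi⟩ := hx
  refine le_trans ?_ (PiLp.norm_apply_le _ i)
  rw [PiLp.smul_apply, norm_smul, norm_inv, Real.norm_natCast, le_inv_mul_iff₀ hM', Real.norm_eq_abs,
    le_abs]
  by_contra! hcon
  apply hi
  constructor
  · linarith [hcon.2]
  · push_cast
    linarith [hcon.1]

/-- The trigonometric polynomial with the coefficients `c`, cut off by the dilated bump. -/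
def cutoffPoly (c : (Fin N → ℤ) →₀ ℂ) {M : ℕ} (hM : 0 < M) : 𝓢(Space N, ℂ) :=
  ∑ n ∈ c.support, c n • wavePacket n hM

theorem cutoffPoly_apply (c : (Fin N → ℤ) →₀ ℂ) {M : ℕ} (hM : 0 < M) (x : Space N) :
    cutoffPoly c hM x = ∑ n ∈ c.support, c n * wavePacket n hM x := by
  simp [cutoffPoly, sum_apply]

theorem cutoffPoly_eq (c : (Fin N → ℤ) →₀ ℂ) {M : ℕ} (hM : 0 < M) (x : Space N) :
    cutoffPoly c hM x = trigPoly c (covering N x) * (bump N ((M : ℝ)⁻¹ • x) : ℂ) := by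
  simp only [cutoffPoly_apply, wavePacket_apply, trigPoly, Finset.sum_mul, mul_assoc]

/-- The support lies in a cube of `(4(N+1)M)^N` periods, where the bump is at most 1. -/
theorem eLpNorm_cutoffPoly_le (c : (Fin N → ℤ) →₀ ℂ) {M : ℕ} (hM : 0 < M) {p : ℝ≥0∞}
    (hp' : p ≠ ∞) :
    eLpNorm (cutoffPoly c hM) p volume ≤
      (((4 * (N + 1) * M : ℕ) : ℝ≥0∞) ^ N) ^ (1 / p.toReal) * eLpNorm (trigPoly c) p volume := by
  set b := -(4 * π * (N + 1) * M)
  set L := 4 * (N + 1) * M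
  have h := measurePreserving_covering N b L
  calc eLpNorm (cutoffPoly c hM) p volume
      ≤ eLpNorm ((cube N b L).indicator (trigPoly c ∘ covering N)) p volume := by
        refine eLpNorm_mono_enorm_ae (Filter.Eventually.of_forall fun x => ?_)
        rw [cutoffPoly_eq]
        by_cases hx : x ∈ cube N b L
        · rw [Set.indicator_of_mem hx, enorm_mul]
          refine mul_le_of_le_one_right' ?_
          rw [← ofReal_norm, Complex.norm_real, Real.norm_of_nonneg (bump N).nonneg]
          exact ENNReal.ofReal_le_one.mpr (bump N).le_one
        · rw [bump_eq_zero hM hx]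
          simp
    _ = _ := by
        rw [eLpNorm_indicator_eq_eLpNorm_restrict (measurableSet_cube _ _ _),
          eLpNorm_comp_measurePreserving (continuous_trigPoly c).aestronglyMeasurable h,
          eLpNorm_smul_measure_of_ne_top hp', smul_eq_mul]
        simp

/-- The uniform error of the comparison of the partial integrals with the partial sums. -/
def cutoffError (a : ℝ) (K : ℕ) (c : (Fin N → ℤ) →₀ ℂ) (M : ℕ) : ℝ :=
  ∑ k ∈ Finset.range K, ∑ n ∈ c.support,
    ‖c n‖ * symbolError a ((k : ℝ) + 1 / 2) (schwartzBump N) (latticeVec n) M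

theorem tendsto_cutoffError (a : ℝ) (K : ℕ) (c : (Fin N → ℤ) →₀ ℂ) :
    Filter.Tendsto (cutoffError a K c) Filter.atTop (nhds 0) := by
  have : (0 : ℝ) = ∑ k ∈ Finset.range K, ∑ n ∈ c.support, ‖c n‖ * 0 := by simp
  rw [this]
  refine tendsto_finsetSum _ fun k _ => tendsto_finsetSum _ fun n _ => ?_
  refine Filter.Tendsto.const_mul _ (tendsto_symbolError a _ ?_)
  rw [norm_latticeVec_sq]
  exact latticeNormSq_ne n k

theorem norm_partialSum_sub_partialIntegral_le (a r : ℝ) (c : (Fin N → ℤ) →₀ ℂ) {M : ℕ}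
    (hM : 0 < M) {x : Space N} (hx : x ∈ cube N 0 M) :
    ‖partialSum a r (trigPoly c) (covering N x) - partialIntegral a r (cutoffPoly c hM) x‖ ≤
      ∑ n ∈ c.support, ‖c n‖ * symbolError a r (schwartzBump N) (latticeVec n) M := by
  have hg : (cutoffPoly c hM : Space N → ℂ) = fun y => ∑ n ∈ c.support, c n * wavePacket n hM y :=
    funext (cutoffPoly_apply c hM)
  rw [partialSum_trigPoly, hg, partialIntegral_sum, ← Finset.sum_sub_distrib]
  refine (norm_sum_le _ _).trans (Finset.sum_le_sum fun n _ => ?_)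
  rw [← mul_sub, norm_mul, norm_sub_rev]
  refine mul_le_mul_of_nonneg_left ?_ (norm_nonneg _)
  have h := norm_partialIntegral_sub_le a r (schwartzBump N) (wavePacket n hM) (latticeVec n)
    (M := M) (by exact_mod_cast hM) (wavePacket_eq n hM) x
  rw [wavePacket_apply, bump_eq_one hM hx, Complex.ofReal_one, mul_one, symbol,
    norm_latticeVec_sq] at h
  exact h

theorem symbolError_nonneg (a r : ℝ) (φ : Space N → ℂ) (v : Space N) (M : ℝ) :
    0 ≤ symbolError a r φ v M :=
  mul_nonneg (unitaryFactor_pos N).le (integral_nonneg fun _ => by positivity)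

theorem truncatedSum_covering_le (a : ℝ) (K : ℕ) (c : (Fin N → ℤ) →₀ ℂ) {M : ℕ}
    (hM : 0 < M) {x : Space N} (hx : x ∈ cube N 0 M) :
    truncatedSum a K (trigPoly c) (covering N x) ≤
      maximalIntegral a (cutoffPoly c hM) x + ENNReal.ofReal (cutoffError a K c M) := by
  refine Finset.sup_le fun k hk => ?_
  have h := norm_partialSum_sub_partialIntegral_le a ((k : ℝ) + 1 / 2) c hM hx
  have h1 := enorm_add_le (partialIntegral a ((k : ℝ) + 1 / 2) (cutoffPoly c hM) x)
    (partialSum a ((k : ℝ) + 1 / 2) (trigPoly c) (covering N x) -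
      partialIntegral a ((k : ℝ) + 1 / 2) (cutoffPoly c hM) x)
  rw [add_sub_cancel] at h1
  refine h1.trans (add_le_add ?_ ?_)
  · exact le_iSup₂_of_le (f := fun r _ => ‖partialIntegral a r (cutoffPoly c hM) x‖ₑ)
      ((k : ℝ) + 1 / 2) (by positivity) le_rfl
  · rw [← ofReal_norm]
    refine ENNReal.ofReal_le_ofReal (h.trans ?_)
    exact Finset.single_le_sum (f := fun k : ℕ => ∑ n ∈ c.support,
      ‖c n‖ * symbolError a ((k : ℝ) + 1 / 2) (schwartzBump N) (latticeVec n) M)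
      (fun _ _ => Finset.sum_nonneg fun _ _ =>
        mul_nonneg (norm_nonneg _) (symbolError_nonneg _ _ _ _ _)) hk

/-- The order of choices matters: `K` fixes the crude constant `C`, then the polynomial is taken
close to `G` relative to `C`, and only then `M` is taken large for this polynomial. -/
theorem exists_schwartz_transference (a : ℝ) (K : ℕ) {p : ℝ≥0∞} (hp : 1 ≤ p) (hp' : p ≠ ∞)
    {G : Torus N → ℂ} (hG : MemLp G p volume) {ε : ℝ≥0} (hε : 0 < ε) :
    ∃ M : ℕ, 0 < M ∧ ∃ g : 𝓢(Space N, ℂ),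
      (∀ x ∈ cube N 0 M, truncatedSum a K G (covering N x) - ε ≤ maximalIntegral a g x) ∧
      eLpNorm g p volume ≤ (((4 * (N + 1) * M : ℕ) : ℝ≥0∞) ^ N) ^ (1 / p.toReal) *
        (eLpNorm G p volume + ε) := by
  obtain ⟨C, hC⟩ := exists_truncatedSum_le N a K hp
  -- The bound `η ≤ ε` controls the norm of the polynomial, and `C * η ≤ ε / 2` controls its
  -- truncated sums; the other half of `ε` is left for the cut-off error.
  obtain ⟨η, hη, hη1, hη2⟩ : ∃ η : ℝ≥0, 0 < η ∧ η ≤ ε ∧ C * η ≤ ε / 2 := by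
    refine ⟨min ε (ε / 2 / (C + 1)), by positivity, min_le_left _ _, ?_⟩
    calc C * min ε (ε / 2 / (C + 1)) ≤ (C + 1) * (ε / 2 / (C + 1)) := by
          gcongr
          · exact le_self_add
          · exact min_le_right _ _
      _ = ε / 2 := by field_simp
  obtain ⟨c, hc⟩ := exists_trigPoly_eLpNorm_sub_le hp' hG
    (ε := (η : ℝ≥0∞)) (by exact_mod_cast hη.ne')
  have hH : MemLp (trigPoly c) p (volume : Measure (Torus N)) :=
    (continuous_trigPoly c).memLp_of_hasCompactSupport (HasCompactSupport.of_compactSpace _)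
  have hε2 : (0 : ℝ) < ((ε / 2 : ℝ≥0) : ℝ) := by exact_mod_cast half_pos hε
  obtain ⟨M, hM1, hM⟩ := (((tendsto_cutoffError a K c).eventually_lt_const hε2).and
    (Filter.eventually_gt_atTop 0)).exists
  refine ⟨M, hM, cutoffPoly c hM, fun x hx => ?_, ?_⟩
  · rw [tsub_le_iff_right]
    calc truncatedSum a K G (covering N x)
        ≤ truncatedSum a K (trigPoly c) (covering N x) + C * η :=
          (hC G (trigPoly c) hG hH _).trans (by gcongr)
      _ ≤ maximalIntegral a (cutoffPoly c hM) x + ENNReal.ofReal (cutoffError a K c M) + C * η := by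
          gcongr
          exact truncatedSum_covering_le a K c hM hx
      _ ≤ maximalIntegral a (cutoffPoly c hM) x + (ε / 2 : ℝ≥0) + (ε / 2 : ℝ≥0) := by
          gcongr
          · rw [← ENNReal.ofReal_coe_nnreal]
            exact ENNReal.ofReal_le_ofReal hM1.le
          · exact_mod_cast hη2
      _ = maximalIntegral a (cutoffPoly c hM) x + ε := by
          rw [add_assoc, ← ENNReal.coe_add, add_halves]
  · refine (eLpNorm_cutoffPoly_le c hM hp').trans ?_
    gcongr
    have h1 := eLpNorm_sub_le (μ := volume) hG.1 (hG.1.sub hH.1) hp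
    rw [sub_sub_cancel] at h1
    refine h1.trans (add_le_add le_rfl (hc.trans ?_))
    exact_mod_cast hη1

/-- The properties of the `L_p` norm and of the weak `L_p` norm of functions with values in
`[0, ∞]` that allow the transference. -/
structure IsTransferable (p : ℝ≥0∞)
    (Φ : ∀ {X : Type} [MeasurableSpace X], (X → ℝ≥0∞) → Measure X → ℝ≥0∞) : Prop where
  smul_measure : ∀ {X : Type} [MeasurableSpace X] (f : X → ℝ≥0∞) (μ : Measure X) (c : ℝ≥0∞),
    c ^ (1 / p.toReal) * Φ f μ ≤ Φ f (c • μ)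
  -- Measurability is asked only of the function on the target: `h` will be the maximal integral, a
  -- supremum over uncountably many radii.
  comp_le : ∀ {X Y : Type} [MeasurableSpace X] [MeasurableSpace Y] {f : Y → ℝ≥0∞} {h : X → ℝ≥0∞}
    {e : X → Y} {μ : Measure X} {ν : Measure Y} {s : Set X}, Measurable f → MeasurableSet s →
    MeasurePreserving e (μ.restrict s) ν → (∀ x ∈ s, f (e x) ≤ h x) → Φ f ν ≤ Φ h μ
  mono : ∀ {X : Type} [MeasurableSpace X] {f g : X → ℝ≥0∞} (μ : Measure X),
    (∀ x, f x ≤ g x) → Φ f μ ≤ Φ g μ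
  iSup_le : ∀ {X : Type} [MeasurableSpace X] {f : ℕ → X → ℝ≥0∞} {μ : Measure X} {B : ℝ≥0∞},
    (∀ j, Measurable (f j)) → Monotone f → (∀ j, Φ (f j) μ ≤ B) → Φ (fun x => ⨆ j, f j x) μ ≤ B

theorem isTransferable_eLpNorm {p : ℝ≥0∞} (hp0 : p ≠ 0) (hp' : p ≠ ∞) :
    IsTransferable p fun f μ => eLpNorm f p μ where
  smul_measure f μ c := by
    rw [eLpNorm_smul_measure_of_ne_top hp', smul_eq_mul]
    simp
  comp_le {X Y _ _ f h e μ ν s} hf hs he hle := by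
    rw [← eLpNorm_comp_measurePreserving hf.aestronglyMeasurable he]
    refine (eLpNorm_mono_enorm_ae ?_).trans (eLpNorm_mono_measure h Measure.restrict_le_self)
    exact ae_restrict_of_forall_mem hs hle
  mono μ h := eLpNorm_mono_enorm_ae (Filter.Eventually.of_forall h)
  iSup_le {X _ f μ B} hf hmono hB := by
    have hp : 0 < p.toReal := ENNReal.toReal_pos hp0 hp'
    simp only [eLpNorm_eq_lintegral_rpow_enorm_toReal hp0 hp', enorm_eq_self, one_div,
      ENNReal.rpow_inv_le_iff hp] at hB ⊢
    calc ∫⁻ x, (⨆ j, f j x) ^ p.toReal ∂μ ≤ ∫⁻ x, ⨆ j, f j x ^ p.toReal ∂μ := by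
          refine lintegral_mono fun x => ?_
          rw [← ENNReal.le_rpow_inv_iff hp]
          refine iSup_le fun j => ?_
          rw [ENNReal.le_rpow_inv_iff hp]
          exact le_iSup (fun j => f j x ^ p.toReal) j
      _ = ⨆ j, ∫⁻ x, f j x ^ p.toReal ∂μ :=
          lintegral_iSup (fun j => (hf j).pow_const _)
            fun i j hij x => ENNReal.rpow_le_rpow (hmono hij x) hp.le
      _ ≤ _ := iSup_le hB

/-- Everything reduces to level sets. Since the inequality is strict, the level set of an increasing
supremum is the increasing union of the level sets, and continuity from below applies. -/
theorem isTransferable_weakNorm {p : ℝ≥0∞} (hp0 : p ≠ 0) (hp' : p ≠ ∞) :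
    IsTransferable p fun f μ => weakNorm f p μ where
  smul_measure f μ c := by
    have hp : 0 < p.toReal := ENNReal.toReal_pos hp0 hp'
    simp only [weakNorm, ENNReal.mul_iSup]
    refine iSup₂_mono fun t _ => le_of_eq ?_
    rw [Measure.smul_apply, smul_eq_mul, ENNReal.mul_rpow_of_nonneg _ _ (by positivity),
      mul_left_comm]
  comp_le {X Y _ _ f h e μ ν s} hf hs he hle := by
    refine iSup₂_mono fun t _ => ?_
    refine mul_le_mul_right (ENNReal.rpow_le_rpow ?_ (by positivity)) _
    rw [← he.measure_preimage (measurableSet_lt measurable_const hf).nullMeasurableSet,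
      Measure.restrict_apply' hs]
    exact measure_mono fun x hx => lt_of_lt_of_le hx.1 (hle x hx.2)
  mono μ h := by
    refine iSup₂_mono fun t _ => ?_
    refine mul_le_mul_right (ENNReal.rpow_le_rpow ?_ (by positivity)) _
    exact measure_mono fun x hx => lt_of_lt_of_le hx (h x)
  iSup_le {X _ f μ B} hf hmono hB := by
    have hp : 0 < p.toReal := ENNReal.toReal_pos hp0 hp'
    refine iSup₂_le fun t ht => ?_
    have ht0 : (t : ℝ≥0∞) ≠ 0 := by exact_mod_cast ht.ne'
    have key : ∀ m : ℝ≥0∞, (t : ℝ≥0∞) * m ^ (1 / p.toReal) ≤ B ↔ m ≤ (B / t) ^ p.toReal := by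
      intro m
      rw [one_div, ← ENNReal.rpow_inv_le_iff hp, mul_comm,
        ENNReal.le_div_iff_mul_le (Or.inl ht0) (Or.inl ENNReal.coe_ne_top)]
    have hU : {x | (t : ℝ≥0∞) < ⨆ j, f j x} = ⋃ j, {x | (t : ℝ≥0∞) < f j x} := by
      ext x
      simp [lt_iSup_iff]
    have hm : Monotone fun j => {x | (t : ℝ≥0∞) < f j x} :=
      fun i j hij x hx => lt_of_lt_of_le hx (hmono hij x)
    rw [key, hU, hm.measure_iUnion]
    refine iSup_le fun j => ?_
    rw [← key]
    exact (le_iSup₂ (f := fun (t : ℝ≥0) (_ : 0 < t) =>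
      (t : ℝ≥0∞) * μ {x | (t : ℝ≥0∞) < f j x} ^ (1 / p.toReal)) t ht).trans (hB j)

/-! ### Transference and passage to the limit -/

section Transference

variable {p : ℝ≥0∞}
  {Φ : ∀ {X : Type} [MeasurableSpace X], (X → ℝ≥0∞) → Measure X → ℝ≥0∞}

theorem IsTransferable.truncatedSum_le (hΦ : IsTransferable p Φ) (hp : 1 ≤ p) (hp' : p ≠ ∞)
    (a : ℝ) {C : ℝ≥0} (hC : ∀ g : 𝓢(Space N, ℂ), Φ (maximalIntegral a g) volume ≤
      C * eLpNorm g p volume) (K : ℕ) {G : Torus N → ℂ} (hG : MemLp G p volume) {ε : ℝ≥0}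
    (hε : 0 < ε) :
    Φ (fun x => truncatedSum a K G x - ε) volume ≤
      C * (((4 * (N + 1) : ℕ) : ℝ≥0∞) ^ N) ^ (1 / p.toReal) * (eLpNorm G p volume + ε) := by
  obtain ⟨M, hM, g, hg1, hg2⟩ := exists_schwartz_transference a K hp hp' hG hε
  have hq : 0 ≤ 1 / p.toReal := by positivity
  set V : ℝ≥0∞ := ((M : ℝ≥0∞) ^ N) ^ (1 / p.toReal)
  have hMN : (M : ℝ≥0∞) ^ N ≠ 0 := pow_ne_zero _ (by exact_mod_cast hM.ne')
  have hMN' : (M : ℝ≥0∞) ^ N ≠ ∞ := ENNReal.pow_ne_top (ENNReal.natCast_ne_top M)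
  have hV0 : V ≠ 0 := by
    simp only [V, ne_eq, ENNReal.rpow_eq_zero_iff, hMN, hMN', false_and, or_self, not_false_iff]
  have hVt : V ≠ ∞ := ENNReal.rpow_ne_top_of_nonneg hq hMN'
  -- The factor `V = M^{N/p}` comes from the `M^N` copies of the torus in the cube and cancels
  -- against the same factor in the norm of `g`.
  rw [← ENNReal.mul_le_mul_iff_right hV0 hVt]
  calc V * Φ (fun x => truncatedSum a K G x - ε) volume
      ≤ Φ (fun x => truncatedSum a K G x - ε) (((M : ℝ≥0∞) ^ N) • volume) :=
        hΦ.smul_measure _ _ _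
    _ ≤ Φ (maximalIntegral a g) volume :=
        hΦ.comp_le ((measurable_truncatedSum a K G).sub_const _) (measurableSet_cube N 0 M)
          (measurePreserving_covering N 0 M) hg1
    _ ≤ C * ((((4 * (N + 1) * M : ℕ) : ℝ≥0∞) ^ N) ^ (1 / p.toReal) *
        (eLpNorm G p volume + ε)) := (hC g).trans (by gcongr)
    _ = _ := by
        rw [Nat.cast_mul, mul_pow, ENNReal.mul_rpow_of_nonneg _ _ hq]
        ring

/-- No triangle inequality is assumed for `Φ`, so the error stays subtracted inside the function and
is removed by monotone approximation. -/
theorem IsTransferable.exists_maximalSum_le (hΦ : IsTransferable p Φ) (hp : 1 ≤ p) (hp' : p ≠ ∞)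
    (a : ℝ) (h : ∃ C : ℝ≥0, ∀ g : 𝓢(Space N, ℂ), Φ (maximalIntegral a g) volume ≤
      C * eLpNorm g p volume) :
    ∃ C : ℝ≥0, ∀ G : Torus N → ℂ, MemLp G p volume →
      Φ (maximalSum a G) volume ≤ C * eLpNorm G p volume := by
  obtain ⟨C, hC⟩ := h
  set A : ℝ≥0∞ := C * (((4 * (N + 1) : ℕ) : ℝ≥0∞) ^ N) ^ (1 / p.toReal)
  have hA : A ≠ ∞ := ENNReal.mul_ne_top ENNReal.coe_ne_top
    (ENNReal.rpow_ne_top_of_nonneg (by positivity)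
      (ENNReal.pow_ne_top (ENNReal.natCast_ne_top _)))
  refine ⟨A.toNNReal, fun G hG => ?_⟩
  rw [ENNReal.coe_toNNReal hA]
  -- The errors decrease, so that the truncated sums minus `δ j` increase with `j`.
  set δ : ℕ → ℝ≥0 := fun j => ((j : ℝ≥0) + 1)⁻¹
  have hδ0 : ∀ j, 0 < δ j := fun j => by positivity
  have hδ : Antitone δ := fun i j hij => by
    have : (i : ℝ≥0) ≤ j := by exact_mod_cast hij
    exact inv_anti₀ (by positivity) (by gcongr)
  have hδt : Filter.Tendsto (fun j => (δ j : ℝ≥0∞)) Filter.atTop (nhds 0) := by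
    have := ENNReal.tendsto_inv_nat_nhds_zero.comp (Filter.tendsto_add_atTop_nat 1)
    refine this.congr fun j => ?_
    simp [δ, ENNReal.coe_inv]
  set f : ℕ → Torus N → ℝ≥0∞ := fun j x => truncatedSum a j G x - δ j
  have hf : ∀ j, Measurable (f j) := fun j => (measurable_truncatedSum a j G).sub_const _
  have hfm : Monotone f := fun i j hij x =>
    tsub_le_tsub (truncatedSum_mono a G x hij) (ENNReal.coe_le_coe.mpr (hδ hij))
  have hfB : ∀ j, Φ (f j) volume ≤ A * eLpNorm G p volume := by
    intro j
    have hlim : Filter.Tendsto (fun i => A * (eLpNorm G p volume + δ i)) Filter.atTop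
        (nhds (A * eLpNorm G p volume)) := by
      have := ENNReal.Tendsto.const_mul (hδt.const_add (eLpNorm G p volume)) (Or.inr hA)
      rwa [add_zero] at this
    -- For `i ≥ j` the function `f j` is below the `j`-th truncated sum minus the smaller error `δ
    -- i`; letting `i` grow removes the error from the bound while `j` stays fixed.
    refine ge_of_tendsto hlim ?_
    filter_upwards [Filter.eventually_ge_atTop j] with i hi
    refine (hΦ.mono volume fun x => ?_).trans (hΦ.truncatedSum_le hp hp' a hC j hG (hδ0 i))
    exact tsub_le_tsub_left (ENNReal.coe_le_coe.mpr (hδ hi)) _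
  refine (hΦ.mono volume fun x => ?_).trans (hΦ.iSup_le hf hfm hfB)
  rw [maximalSum_eq_iSup]
  refine _root_.iSup_le fun K => ?_
  -- For `i ≥ K` the `K`-th truncated sum is at most `f i x + δ i`, so the supremum of the `f j`
  -- loses nothing in the limit.
  have hlim := hδt.const_add (⨆ j, f j x)
  rw [add_zero] at hlim
  refine ge_of_tendsto hlim ?_
  filter_upwards [Filter.eventually_ge_atTop K] with i hi
  rw [← tsub_le_iff_right]
  exact (tsub_le_tsub_right (truncatedSum_mono a G x hi) _).trans (le_iSup (fun j => f j x) i)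

end Transference

end SphericalMeans

end

theorem theorem2 (N : ℕ) (a : ℝ) (p : ℝ≥0∞) (hp : 1 < p) (hp' : p < ∞) :
    (SphericalMeans.IntegralBounded N a p → SphericalMeans.SumBounded N a p) ∧
    (SphericalMeans.IntegralWeaklyBounded N a p → SphericalMeans.SumWeaklyBounded N a p) :=
  have hp0 : p ≠ 0 := (zero_lt_one.trans hp).ne'
  ⟨(SphericalMeans.isTransferable_eLpNorm hp0 hp'.ne).exists_maximalSum_le hp.le hp'.ne a,
    (SphericalMeans.isTransferable_weakNorm hp0 hp'.ne).exists_maximalSum_le hp.le hp'.ne a⟩
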